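/- Let $\tau_0(x)=x/4$ and $\tau_2(x)=(x+2)/4$ for $x\in\mathbb R$, and let $\mu$ be the unique Borel probability measure on $\mathbb R$ such that $$\mu(E)=\tfrac12\left(\mu(\tau_0^{-1}E)+\mu(\tau_2^{-1}E)\right)\quad\text{for all Borel sets }E\subset\mathbb R .$$ For a natural number $m$ put $$\Gamma(m)=\Big\{\sum_{k=0}^n 4^k l_k : n\in\mathbb N,\ l_0,\dots,l_n\in\{0,m\}\Big\}.$$ An odd natural number $m$ is called complete if the exponential functions $e_\lambda(x)=e^{2\pi i\lambda x}$, $\lambda\in\Gamma(m)$, form an orthonormal basis of $L^2(\mu)$, and incomplete otherwise. An odd natural number $m$ is called primitive if $m$ is incomplete and every proper divisor $d$ of $m$ (that is, $d\mid m$ with $1\le d<m$) is complete. **Proposition.** (a) Let $m$ and $k$ be odd natural numbers. If $m$ is incomplete, then $km$ is incomplete. (b) An odd natural number $m$ is incomplete if and only if it is divisible by a primitive number. -/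

import Mathlib

open MeasureTheory Filter Topology

namespace CantorSpectrum

/-! ### The invariant measure on the Cantor set -/

/-- The contraction `τ₀(x) = x / 4`. -/
noncomputable def tau0 (x : ℝ) : ℝ := x / 4

/-- The contraction `τ₂(x) = (x + 2) / 4`. -/
noncomputable def tau2 (x : ℝ) : ℝ := (x + 2) / 4

/-- `μ` is a Borel probability measure on `ℝ` with
`μ(E) = (1/2) (μ(τ₀⁻¹ E) + μ(τ₂⁻¹ E))` for all Borel sets `E`. -/
def IsInvariantProbability (μ : Measure ℝ) : Prop :=
  IsProbabilityMeasure μ ∧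
    ∀ E : Set ℝ, MeasurableSet E → μ E = 2⁻¹ * (μ (tau0 ⁻¹' E) + μ (tau2 ⁻¹' E))

theorem measurable_tau0 : Measurable tau0 := by unfold tau0; fun_prop

theorem measurable_tau2 : Measurable tau2 := by unfold tau2; fun_prop

/-- The law of a random base 4 digit that is `0` or `2`, each with probability `1/2`. -/
noncomputable def digitLaw : Measure (Fin 4) :=
  (2⁻¹ : ENNReal) • (Measure.dirac 0 + Measure.dirac 2)

instance : IsProbabilityMeasure digitLaw := by
  constructor
  simp only [digitLaw, Measure.smul_apply, Measure.add_apply, measure_univ, smul_eq_mul]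
  rw [one_add_one_eq_two]
  exact ENNReal.inv_mul_cancel (by norm_num) (by norm_num)

/-- The law of an independent sequence of digits with law `digitLaw`. -/
noncomputable def digitsLaw : Measure (ℕ → Fin 4) := Measure.infinitePi fun _ => digitLaw

instance : IsProbabilityMeasure digitsLaw := by unfold digitsLaw; infer_instance

/-- Put the digit `a` in front of the sequence `x`. -/
def consDigit (a : Fin 4) (x : ℕ → Fin 4) : ℕ → Fin 4
  | 0 => a
  | n + 1 => x n

theorem measurable_consDigit (a : Fin 4) : Measurable (consDigit a) := by
  refine measurable_pi_lambda _ fun n => ?_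
  cases n with
  | zero => exact measurable_const
  | succ n => exact measurable_pi_apply n

theorem digitsLaw_eq : digitsLaw = (2⁻¹ : ENNReal) •
    (digitsLaw.map (consDigit 0) + digitsLaw.map (consDigit 2)) := by
  classical
  symm
  refine Measure.eq_infinitePi _ fun s t ht => ?_
  obtain ⟨N, hN⟩ : ∃ N, s ⊆ Finset.range (N + 1) :=
    ⟨s.sup id, fun i hi => Finset.mem_range.2 (Nat.lt_succ_of_le (Finset.le_sup (f := id) hi))⟩
  set t' : ℕ → Set (Fin 4) := fun i => if i ∈ s then t i else Set.univ with ht'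
  have h1 : Set.pi (s : Set ℕ) t = Set.pi (Finset.range (N + 1) : Set ℕ) t' := by
    ext x
    simp only [Set.mem_pi, Finset.mem_coe, ht']
    refine ⟨fun h i _ => ?_, fun h i hi => ?_⟩
    · by_cases his : i ∈ s
      · simpa [his] using h i his
      · simp [his]
    · simpa [hi] using h i (hN hi)
  have h2 : ∏ i ∈ s, digitLaw (t i) = ∏ i ∈ Finset.range (N + 1), digitLaw (t' i) := by
    rw [← Finset.prod_subset hN (f := fun i => digitLaw (t' i))]
    · exact Finset.prod_congr rfl fun i hi => by simp [ht', hi]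
    · intro i _ hi
      simp [ht', hi]
  have hm : MeasurableSet (Set.pi (Finset.range (N + 1) : Set ℕ) t') :=
    MeasurableSet.pi (Finset.countable_toSet _) fun i _ => MeasurableSet.of_discrete
  have h3 (a : Fin 4) : digitsLaw (consDigit a ⁻¹' Set.pi (Finset.range (N + 1) : Set ℕ) t') =
      Measure.dirac a (t' 0) * ∏ i ∈ Finset.range N, digitLaw (t' (i + 1)) := by
    have key : consDigit a ⁻¹' Set.pi (Finset.range (N + 1) : Set ℕ) t' =
        {_x | a ∈ t' 0} ∩ Set.pi (Finset.range N : Set ℕ) (fun i => t' (i + 1)) := by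
      ext x
      simp only [Set.mem_preimage, Set.mem_pi, Finset.coe_range, Set.mem_Iio, Set.mem_inter_iff,
        Set.mem_ofPred_eq]
      refine ⟨fun h => ⟨h 0 (by omega), fun i hi => h (i + 1) (by omega)⟩, fun h i hi => ?_⟩
      cases i with
      | zero => exact h.1
      | succ i => exact h.2 i (by omega)
    rw [key]
    by_cases ha : a ∈ t' 0
    · simp only [ha, Set.ofPred_true, Set.univ_inter]
      rw [digitsLaw, Measure.infinitePi_pi _ fun i _ => MeasurableSet.of_discrete]
      simp [ha]
    · simp [ha]
  rw [h1, h2, Finset.prod_range_succ', Measure.smul_apply, Measure.add_apply,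
    Measure.map_apply (measurable_consDigit _) hm, Measure.map_apply (measurable_consDigit _) hm,
    h3, h3, ← add_mul, smul_eq_mul, ← mul_assoc, mul_comm]
  simp [digitLaw, mul_add]

theorem ofDigits_consDigit (a : Fin 4) (x : ℕ → Fin 4) :
    Real.ofDigits (consDigit a x) = (Real.ofDigits x + (a : ℕ)) / 4 := by
  rw [Real.ofDigits_eq_sum_add_ofDigits _ 1]
  simp only [Finset.range_one, Finset.sum_singleton, Real.ofDigitsTerm, consDigit]
  norm_num
  ring

theorem isInvariantProbability_map_digitsLaw :
    IsInvariantProbability (digitsLaw.map Real.ofDigits) := by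
  have hc : Measurable (Real.ofDigits (b := 4)) := Real.continuous_ofDigits.measurable
  refine ⟨Measure.isProbabilityMeasure_map hc.aemeasurable, fun E hE => ?_⟩
  have e0 : consDigit 0 ⁻¹' (Real.ofDigits (b := 4) ⁻¹' E) =
      Real.ofDigits (b := 4) ⁻¹' (tau0 ⁻¹' E) := by
    ext x
    simp [ofDigits_consDigit, tau0]
  have e2 : consDigit 2 ⁻¹' (Real.ofDigits (b := 4) ⁻¹' E) =
      Real.ofDigits (b := 4) ⁻¹' (tau2 ⁻¹' E) := by
    ext x
    simp [ofDigits_consDigit, tau2]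
  rw [Measure.map_apply hc hE, Measure.map_apply hc (measurable_tau0 hE),
    Measure.map_apply hc (measurable_tau2 hE), ← e0, ← e2]
  conv_lhs => rw [digitsLaw_eq]
  rw [Measure.smul_apply, Measure.add_apply, Measure.map_apply (measurable_consDigit _) (hc hE),
    Measure.map_apply (measurable_consDigit _) (hc hE), smul_eq_mul]

theorem IsInvariantProbability.charFun_eq {μ : Measure ℝ} (h : IsInvariantProbability μ) (t : ℝ) :
    charFun μ t = 2⁻¹ * (1 + Complex.exp ((t / 2 : ℝ) * Complex.I)) * charFun μ (t / 4) := by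
  have := h.1
  have hμ : μ = (2⁻¹ : ENNReal) • (μ.map tau0 + μ.map tau2) := by
    ext E hE
    rw [Measure.smul_apply, Measure.add_apply, Measure.map_apply measurable_tau0 hE,
      Measure.map_apply measurable_tau2 hE, smul_eq_mul]
    exact h.2 E hE
  have hp0 : IsProbabilityMeasure (μ.map tau0) :=
    Measure.isProbabilityMeasure_map measurable_tau0.aemeasurable
  have hp2 : IsProbabilityMeasure (μ.map tau2) :=
    Measure.isProbabilityMeasure_map measurable_tau2.aemeasurable
  have hcont : Continuous fun x : ℝ => Complex.exp (t * x * Complex.I) := by fun_prop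
  have hint (ν : Measure ℝ) [IsProbabilityMeasure ν] :
      Integrable (fun x : ℝ => Complex.exp (t * x * Complex.I)) ν := by
    refine Integrable.of_bound hcont.aestronglyMeasurable 1 (ae_of_all _ fun x => ?_)
    rw [← Complex.ofReal_mul, Complex.norm_exp_ofReal_mul_I]
  have h0 : ∫ x, Complex.exp (t * x * Complex.I) ∂(μ.map tau0) = charFun μ (t / 4) := by
    rw [integral_map measurable_tau0.aemeasurable hcont.aestronglyMeasurable, charFun_apply_real]
    refine integral_congr_ae (ae_of_all _ fun x => ?_)
    simp only [tau0]
    congr 1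
    push_cast
    ring
  have h2 : ∫ x, Complex.exp (t * x * Complex.I) ∂(μ.map tau2) =
      Complex.exp ((t / 2 : ℝ) * Complex.I) * charFun μ (t / 4) := by
    rw [integral_map measurable_tau2.aemeasurable hcont.aestronglyMeasurable, charFun_apply_real,
      ← integral_const_mul]
    refine integral_congr_ae (ae_of_all _ fun x => ?_)
    simp only [tau2]
    rw [← Complex.exp_add]
    congr 1
    push_cast
    ring
  rw [charFun_apply_real]
  conv_lhs => rw [hμ]
  rw [integral_smul_measure, integral_add_measure (hint _) (hint _), h0, h2]
  simp
  ring

/-- There is exactly one Borel probability measure satisfying the invariance equation. -/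
theorem existsUnique_isInvariantProbability : ∃! μ : Measure ℝ, IsInvariantProbability μ := by
  refine ⟨_, isInvariantProbability_map_digitsLaw, fun μ hμ => ?_⟩
  have hν := isInvariantProbability_map_digitsLaw
  set ν : Measure ℝ := digitsLaw.map Real.ofDigits
  have := hμ.1
  have := hν.1
  refine Measure.ext_of_charFun (funext fun t => ?_)
  have hstep (t : ℝ) : ‖charFun μ t - charFun ν t‖ ≤ ‖charFun μ (t / 4) - charFun ν (t / 4)‖ := by
    rw [hμ.charFun_eq t, hν.charFun_eq t, ← mul_sub, norm_mul]
    refine mul_le_of_le_one_left (norm_nonneg _) ?_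
    rw [norm_mul]
    have := norm_add_le (1 : ℂ) (Complex.exp ((t / 2 : ℝ) * Complex.I))
    rw [Complex.norm_exp_ofReal_mul_I, norm_one] at this
    norm_num at this ⊢
    linarith
  have hiter (n : ℕ) :
      ‖charFun μ t - charFun ν t‖ ≤ ‖charFun μ (t / 4 ^ n) - charFun ν (t / 4 ^ n)‖ := by
    induction n with
    | zero => simp
    | succ n ih =>
      refine ih.trans ((hstep _).trans_eq ?_)
      rw [div_div, ← pow_succ]
  have hlim : Tendsto (fun n : ℕ => t / (4 : ℝ) ^ n) atTop (𝓝 0) :=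
    (tendsto_pow_atTop_atTop_of_one_lt (by norm_num)).const_div_atTop t
  have hF : Continuous fun s : ℝ => ‖charFun μ s - charFun ν s‖ :=
    (continuous_charFun.sub continuous_charFun).norm
  have h0 := (hF.tendsto 0).comp hlim
  have hle := ge_of_tendsto' h0 hiter
  simp only [charFun_zero, probReal_univ, sub_self, norm_zero] at hle
  exact sub_eq_zero.1 (norm_le_zero_iff.1 hle)

/-- The measure `μ` on the Cantor set `X₄`: the unique Borel probability measure on `ℝ` that is
invariant for the iterated function system `τ₀, τ₂`. -/
noncomputable def cantorMeasure : Measure ℝ := existsUnique_isInvariantProbability.choose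

theorem isInvariantProbability_cantorMeasure : IsInvariantProbability cantorMeasure :=
  existsUnique_isInvariantProbability.choose_spec.1

instance : IsProbabilityMeasure cantorMeasure := isInvariantProbability_cantorMeasure.1

/-! ### Spectra -/

/-- The exponential function `e_lam(x) = exp (2 π i lam x)`. -/
noncomputable def expFun (lam : ℝ) (x : ℝ) : ℂ :=
  Complex.exp (2 * Real.pi * Complex.I * lam * x)

theorem memLp_expFun (μ : Measure ℝ) [IsFiniteMeasure μ] (lam : ℝ) : MemLp (expFun lam) 2 μ := by
  have hc : Continuous (expFun lam) := by unfold expFun; fun_prop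
  refine MemLp.of_bound hc.aestronglyMeasurable 1 (ae_of_all _ fun x => ?_)
  have : (2 * Real.pi * Complex.I * lam * x : ℂ) = (2 * Real.pi * lam * x : ℝ) * Complex.I := by
    push_cast
    ring
  rw [expFun, this, Complex.norm_exp_ofReal_mul_I]

/-- The class of `e_lam` in `L²(μ)`. -/
noncomputable def expLp (μ : Measure ℝ) [IsFiniteMeasure μ] (lam : ℝ) : Lp ℂ 2 μ :=
  (memLp_expFun μ lam).toLp (expFun lam)

/-- `Γ` is a spectrum for `μ`: the family `e_lam`, `lam ∈ Γ`, is an orthonormal (Hilbert) basis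
of `L²(μ)`. -/
def IsSpectrum (μ : Measure ℝ) [IsFiniteMeasure μ] (Γ : Set ℝ) : Prop :=
  ∃ b : HilbertBasis Γ ℂ (Lp ℂ 2 μ), ∀ lam : Γ, b lam = expLp μ lam

/-- `Γ(m)`: the set of all finite sums `∑ₖ 4ᵏ lₖ`, `0 ≤ k ≤ n`, with digits `lₖ ∈ {0, m}`. -/
def Gam (m : ℕ) : Set ℝ :=
  {x | ∃ (n : ℕ) (l : ℕ → ℝ), (∀ k, l k = 0 ∨ l k = m) ∧
    x = ∑ k ∈ Finset.range (n + 1), 4 ^ k * l k}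

/-! ### Complete, incomplete and primitive odd numbers -/

/-- An (odd) number `m` is complete if `Γ(m)` is a spectrum for the measure `μ`. -/
def IsComplete (m : ℕ) : Prop := IsSpectrum cantorMeasure (Gam m)

/-- An (odd) number `m` is incomplete if it is not complete. -/
def IsIncomplete (m : ℕ) : Prop := ¬ IsComplete m

/-- An odd number is primitive if it is incomplete and all its proper divisors are complete. -/
def IsPrimitive (m : ℕ) : Prop :=
  Odd m ∧ IsIncomplete m ∧ ∀ d ∈ m.properDivisors, IsComplete d

end CantorSpectrum

namespace CantorSpectrum

/-! ### The Fourier transform of the Cantor measure -/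

/-! Everything rests on a criterion (`isComplete_iff`): `m` fails to be complete exactly when some
integer `x` has `μ̂(x + λ) = 0` for all `λ ∈ Γ(m)`. The zeros of `μ̂` are the numbers `4ⁿ z` with
`z` odd, a set stable under odd factors, and `Γ(km) = k Γ(m)`; so a witness `x` for `m` gives the
witness `kx` for `km`, which is (a). Part (b) follows by descent to a minimal incomplete divisor.

In the criterion, such an `x` makes `e_{-x}` a nonzero vector orthogonal to the family. Conversely,
consider `Q(t) = ∑ |μ̂(t + λ)|²`. Bessel gives `Q ≤ 1`, and since all exponentials together are
total, `Q ≥ 1` suffices for completeness. Splitting off the lowest digit of `λ` writes `Q(t)` as a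
weighted mean of `Q(t/4)` and `Q((t+m)/4)`, so a minimum of `Q` on a large interval propagates along
every branch of nonzero weight. If some `μ̂(t + λ)` is nonzero at the minimum point `t`, the digits
of `λ` followed by zeros give such a path; it tends to `0`, where `Q ≥ 1`
(`one_le_of_isMinOn_spectral`). If all `μ̂(t + λ)` vanished, then `t` would be an integer, which the
hypothesis excludes. -/

/-- The Fourier transform `∫ e_t dμ` of the Cantor measure. -/
noncomputable def fourier (t : ℝ) : ℂ := charFun cantorMeasure (2 * Real.pi * t)

/-- The symbol `(1 + exp (π i t)) / 2` of the iterated function system. -/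
noncomputable def symbol (t : ℝ) : ℂ := 2⁻¹ * (1 + Complex.exp ((Real.pi * t : ℝ) * Complex.I))

theorem fourier_eq (t : ℝ) : fourier t = symbol t * fourier (t / 4) := by
  rw [fourier, isInvariantProbability_cantorMeasure.charFun_eq, symbol, fourier]
  congr 4 <;> ring_nf

theorem continuous_fourier : Continuous fourier :=
  continuous_charFun.comp (continuous_const.mul continuous_id)

@[simp] theorem fourier_zero : fourier 0 = 1 := by simp [fourier]

theorem symbol_add_even (t : ℝ) (z : ℤ) : symbol (t + 2 * z) = symbol t := by
  rw [symbol, symbol]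
  have : ((Real.pi * (t + 2 * z) : ℝ) * Complex.I : ℂ) =
      (Real.pi * t : ℝ) * Complex.I + z * (2 * Real.pi * Complex.I) := by
    push_cast; ring
  rw [this, Complex.exp_add, Complex.exp_int_mul_two_pi_mul_I, mul_one]

theorem exp_add_one (t : ℝ) : Complex.exp ((Real.pi * (t + 1) : ℝ) * Complex.I) =
    -Complex.exp ((Real.pi * t : ℝ) * Complex.I) := by
  have : ((Real.pi * (t + 1) : ℝ) * Complex.I : ℂ) =
      (Real.pi * t : ℝ) * Complex.I + Real.pi * Complex.I := by
    push_cast; ring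
  rw [this, Complex.exp_add, Complex.exp_pi_mul_I, mul_neg_one]

/-- An odd shift flips the sign of the exponential, so this is the parallelogram law for `1` and a
unit vector. It makes the two branch weights of `spectral_eq` sum to one. -/
theorem norm_sq_symbol_add_odd (t : ℝ) {z : ℤ} (hz : Odd z) :
    ‖symbol t‖ ^ 2 + ‖symbol (t + z)‖ ^ 2 = 1 := by
  obtain ⟨w, rfl⟩ := hz
  have h : t + ((2 * w + 1 : ℤ) : ℝ) = (t + 1) + 2 * w := by push_cast; ring
  rw [h, symbol_add_even, symbol, symbol, exp_add_one]
  set u := Complex.exp ((Real.pi * t : ℝ) * Complex.I)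
  have hu : ‖u‖ = 1 := Complex.norm_exp_ofReal_mul_I _
  have := parallelogram_law_with_norm ℝ (1 : ℂ) u
  rw [hu, norm_one] at this
  rw [norm_mul, norm_mul, ← sub_eq_add_neg]
  norm_num
  nlinarith

theorem symbol_zero : symbol 0 = 1 := by norm_num [symbol]

theorem symbol_even (z : ℤ) : symbol (2 * z) = 1 := by
  rw [← zero_add (2 * (z : ℝ)), symbol_add_even, symbol_zero]

theorem symbol_eq_zero_iff {t : ℝ} : symbol t = 0 ↔ ∃ z : ℤ, Odd z ∧ t = z := by
  constructor
  · intro h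
    have h1 : Complex.exp ((Real.pi * (t + 1) : ℝ) * Complex.I) = 1 := by
      rw [exp_add_one]
      have : (1 : ℂ) + Complex.exp ((Real.pi * t : ℝ) * Complex.I) = 0 := by
        simpa [symbol] using h
      linear_combination -this
    obtain ⟨n, hn⟩ := Complex.exp_eq_one_iff.1 h1
    refine ⟨2 * (n - 1) + 1, odd_two_mul_add_one _, ?_⟩
    have h2 : ((Real.pi * (t + 1) : ℝ) : ℂ) = (n * (2 * Real.pi) : ℝ) := by
      apply mul_right_cancel₀ Complex.I_ne_zero
      rw [hn]; push_cast; ring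
    have h3 := Complex.ofReal_injective h2
    have h4 : t + 1 = 2 * n := by
      apply mul_left_cancel₀ Real.pi_ne_zero
      rw [h3]; ring
    push_cast
    linarith
  · rintro ⟨z, hz, rfl⟩
    have := norm_sq_symbol_add_odd 0 hz
    rw [symbol_zero, zero_add] at this
    simpa using this

theorem tendsto_div_four_pow (t : ℝ) : Tendsto (fun n : ℕ => t / (4 : ℝ) ^ n) atTop (𝓝 0) :=
  (tendsto_pow_atTop_atTop_of_one_lt (by norm_num)).const_div_atTop t

theorem fourier_four_mul_int (z : ℤ) : fourier (4 * z) = fourier z := by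
  have h : (4 * z : ℝ) = 2 * ((2 * z : ℤ) : ℝ) := by push_cast; ring
  rw [fourier_eq, h, symbol_even, one_mul]
  congr 1
  push_cast; ring

theorem fourier_odd {z : ℤ} (hz : Odd z) : fourier z = 0 := by
  rw [fourier_eq, symbol_eq_zero_iff.2 ⟨z, hz, rfl⟩, zero_mul]

/-- The zeros of the Fourier transform of `μ` are the numbers `4ⁿ z` with `z` odd. -/
theorem fourier_eq_zero_iff {t : ℝ} :
    fourier t = 0 ↔ ∃ (n : ℕ) (z : ℤ), Odd z ∧ t = 4 ^ n * z := by
  constructor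
  · intro h
    by_contra! hne
    -- No factor `symbol (t / 4 ^ n)` vanishes, so the zero is passed down to points tending to `0`,
    -- against continuity and `fourier 0 = 1`.
    have hall (n : ℕ) : fourier (t / 4 ^ n) = 0 := by
      induction n with
      | zero => simpa using h
      | succ n ih =>
        rw [fourier_eq, mul_eq_zero] at ih
        rw [pow_succ, ← div_div]
        refine ih.resolve_left fun hs => ?_
        obtain ⟨z, hz, hzt⟩ := symbol_eq_zero_iff.1 hs
        refine hne n z hz ?_
        rw [← hzt]; field_simp
    have hlim := (continuous_fourier.tendsto 0).comp (tendsto_div_four_pow t)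
    have : fourier 0 = 0 := tendsto_nhds_unique hlim (by simp [Function.comp_def, hall])
    simp at this
  · rintro ⟨n, z, hz, rfl⟩
    induction n with
    | zero => simpa using fourier_odd hz
    | succ n ih =>
      have h : (4 : ℝ) ^ (n + 1) * z = 4 * ((4 ^ n * z : ℤ) : ℝ) := by push_cast; ring
      rw [h, fourier_four_mul_int]
      exact_mod_cast ih

/-- The zero set of the Fourier transform is invariant under multiplication by odd numbers. -/
theorem fourier_odd_mul_eq_zero {k : ℕ} (hk : Odd k) {t : ℝ} (ht : fourier t = 0) :
    fourier (k * t) = 0 := by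
  obtain ⟨n, z, hz, rfl⟩ := fourier_eq_zero_iff.1 ht
  refine fourier_eq_zero_iff.2 ⟨n, k * z, ((Int.odd_coe_nat k).2 hk).mul hz, ?_⟩
  push_cast; ring

/-! ### Inner products and totality of the exponentials -/

theorem inner_expLp (a b : ℝ) :
    inner ℂ (expLp cantorMeasure a) (expLp cantorMeasure b) = fourier (b - a) := by
  rw [L2.inner_def, fourier, charFun_apply_real]
  refine integral_congr_ae ?_
  filter_upwards [(memLp_expFun cantorMeasure a).coeFn_toLp,
    (memLp_expFun cantorMeasure b).coeFn_toLp] with x ha hb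
  rw [expLp, expLp, ha, hb, RCLike.inner_apply, expFun, expFun, ← Complex.exp_conj,
    ← Complex.exp_add]
  congr 1
  simp only [map_mul, Complex.conj_I, Complex.conj_ofReal, map_ofNat]
  push_cast
  ring

theorem norm_expLp (a : ℝ) : ‖expLp cantorMeasure a‖ = 1 := by
  rw [norm_eq_sqrt_re_inner (𝕜 := ℂ), inner_expLp, sub_self, fourier_zero]
  simp

/-- A real integrable function whose Fourier transform vanishes is zero. -/
theorem ae_eq_zero_of_forall_integral_exp_eq_zero {μ : Measure ℝ} [IsFiniteMeasure μ] {g : ℝ → ℝ}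
    (hg : Integrable g μ)
    (h : ∀ t : ℝ, ∫ x, Complex.exp (t * x * Complex.I) * g x ∂μ = 0) : g =ᵐ[μ] 0 := by
  have hpos := hg.aemeasurable.ennreal_ofReal
  have hneg := hg.neg.aemeasurable.ennreal_ofReal
  have : IsFiniteMeasure (μ.withDensity fun x => ENNReal.ofReal (g x)) :=
    isFiniteMeasure_withDensity_ofReal hg.2
  have : IsFiniteMeasure (μ.withDensity fun x => ENNReal.ofReal ((-g) x)) :=
    isFiniteMeasure_withDensity_ofReal hg.neg.2
  have hbd {f : ℝ → ℝ} (hf : Integrable f μ) (t : ℝ) :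
      Integrable (fun x : ℝ => max (f x) 0 • Complex.exp (t * x * Complex.I)) μ := by
    refine hf.pos_part.smul_bdd 1 ?_ ?_
    · exact (by fun_prop : Continuous fun x : ℝ =>
        Complex.exp (t * x * Complex.I)).aestronglyMeasurable
    · refine ae_of_all _ fun x => ?_
      rw [← Complex.ofReal_mul, Complex.norm_exp_ofReal_mul_I]
  -- The positive and negative parts of `g` are densities of finite measures with the same
  -- characteristic function.
  have key : (μ.withDensity fun x => ENNReal.ofReal (g x)) =
      μ.withDensity fun x => ENNReal.ofReal ((-g) x) := by
    refine Measure.ext_of_charFun (funext fun t => ?_)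
    rw [charFun_apply_real, charFun_apply_real,
      integral_withDensity_eq_integral_toReal_smul₀ hpos (ae_of_all _ fun _ => by simp),
      integral_withDensity_eq_integral_toReal_smul₀ hneg (ae_of_all _ fun _ => by simp),
      ← sub_eq_zero]
    simp only [ENNReal.toReal_ofReal']
    rw [← integral_sub (hbd hg t) (hbd hg.neg t), ← h t]
    refine integral_congr_ae (ae_of_all _ fun x => ?_)
    simp only [← sub_smul, Pi.neg_apply]
    rw [max_zero_sub_eq_self, Complex.real_smul, mul_comm]
  have hae := (withDensity_eq_iff_of_sigmaFinite hpos hneg).1 key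
  filter_upwards [hae] with x hx
  have := congrArg ENNReal.toReal hx
  simp only [ENNReal.toReal_ofReal', Pi.neg_apply] at this
  have h3 := max_zero_sub_eq_self (g x)
  simp only [Pi.zero_apply]
  linarith

/-- The exponential functions are total in `L²(μ)`. -/
theorem eq_zero_of_forall_inner_expLp_eq_zero {μ : Measure ℝ} [IsFiniteMeasure μ]
    {f : Lp ℂ 2 μ} (h : ∀ t : ℝ, inner ℂ (expLp μ t) f = 0) : f = 0 := by
  have hf : Integrable f μ := (Lp.memLp f).integrable (by norm_num)
  have h1 (t : ℝ) : ∫ x, Complex.exp (t * x * Complex.I) * f x ∂μ = 0 := by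
    rw [← h (-t / (2 * Real.pi)), L2.inner_def]
    refine integral_congr_ae ?_
    filter_upwards [(memLp_expFun μ (-t / (2 * Real.pi))).coeFn_toLp] with x hx
    rw [expLp, hx, RCLike.inner_apply, expFun, ← Complex.exp_conj, mul_comm]
    congr 2
    simp only [map_mul, Complex.conj_I, Complex.conj_ofReal, map_ofNat]
    push_cast
    have := Complex.ofReal_ne_zero.2 Real.pi_ne_zero
    field_simp
  have hint {g : ℝ → ℂ} (hg : Integrable g μ) (t : ℝ) :
      Integrable (fun x : ℝ => Complex.exp (t * x * Complex.I) * g x) μ := by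
    refine hg.bdd_mul (c := 1) ?_ ?_
    · exact (by fun_prop : Continuous fun x : ℝ =>
        Complex.exp (t * x * Complex.I)).aestronglyMeasurable
    · refine ae_of_all _ fun x => ?_
      rw [← Complex.ofReal_mul, Complex.norm_exp_ofReal_mul_I]
  have hcj : Integrable (fun x => (starRingEnd ℂ) (f x)) μ :=
    (LinearIsometryEquiv.integrable_comp_iff Complex.conjLIE).2 hf
  -- Conjugation only replaces `t` by `-t`, so the real and imaginary parts of `f` can be treated
  -- separately.
  have h2 (t : ℝ) : ∫ x, Complex.exp (t * x * Complex.I) * (starRingEnd ℂ) (f x) ∂μ = 0 := by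
    have := congrArg (starRingEnd ℂ) (h1 (-t))
    rw [← integral_conj, map_zero] at this
    rw [← this]
    refine integral_congr_ae (ae_of_all _ fun x => ?_)
    simp only [map_mul, ← Complex.exp_conj, Complex.conj_I, Complex.conj_ofReal]
    congr 2
    push_cast; ring
  have hre : (fun x => (f x).re) =ᵐ[μ] 0 := by
    refine ae_eq_zero_of_forall_integral_exp_eq_zero hf.re fun t => ?_
    have := integral_add (hint hf t) (hint hcj t)
    rw [h1, h2, add_zero] at this
    rw [← mul_zero (2⁻¹ : ℂ), ← this, ← integral_const_mul]
    refine integral_congr_ae (ae_of_all _ fun x => ?_)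
    simp only [← mul_add, Complex.add_conj]
    push_cast; ring
  have him : (fun x => (f x).im) =ᵐ[μ] 0 := by
    refine ae_eq_zero_of_forall_integral_exp_eq_zero hf.im fun t => ?_
    have := integral_sub (hint hf t) (hint hcj t)
    rw [h1, h2, sub_zero] at this
    rw [← mul_zero ((2 * Complex.I)⁻¹ : ℂ), ← this, ← integral_const_mul]
    refine integral_congr_ae (ae_of_all _ fun x => ?_)
    simp only [← mul_sub, Complex.sub_conj]
    push_cast
    field_simp
  refine (Lp.eq_zero_iff_ae_eq_zero).2 ?_
  filter_upwards [hre, him] with x h3 h4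
  exact Complex.ext h3 h4

/-! ### Finite sections of `Γ(m)` -/

/-- The sums `∑ₖ 4ᵏ lₖ`, `0 ≤ k < n`, with digits `lₖ ∈ {0, m}`. -/
def digitSums (m : ℕ) : ℕ → Finset ℤ
  | 0 => {0}
  | n + 1 => (digitSums m n).image (4 * ·) ∪ (digitSums m n).image (4 * · + (m : ℤ))

theorem mem_digitSums_succ {m n : ℕ} {z : ℤ} : z ∈ digitSums m (n + 1) ↔
    ∃ w ∈ digitSums m n, z = 4 * w ∨ z = 4 * w + m := by
  simp only [digitSums, Finset.mem_union, Finset.mem_image]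
  grind

theorem digitSums_mono (m : ℕ) : Monotone (digitSums m) := by
  refine monotone_nat_of_le_succ fun n => ?_
  induction n with
  | zero => simp [digitSums]
  | succ n ih =>
    intro z hz
    obtain ⟨w, hw, h⟩ := mem_digitSums_succ.1 hz
    exact mem_digitSums_succ.2 ⟨w, ih hw, h⟩

theorem mem_digitSums_iff {m n : ℕ} {z : ℤ} : z ∈ digitSums m n ↔
    ∃ l : ℕ → ℝ, (∀ k, l k = 0 ∨ l k = m) ∧ (z : ℝ) = ∑ k ∈ Finset.range n, 4 ^ k * l k := by
  induction n generalizing z with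
  | zero =>
    simp only [digitSums, Finset.mem_singleton, Finset.range_zero, Finset.sum_empty,
      Int.cast_eq_zero]
    exact ⟨fun h => ⟨fun _ => 0, by simp, h⟩, fun ⟨_, _, h⟩ => h⟩
  | succ n ih =>
    rw [mem_digitSums_succ]
    constructor
    · rintro ⟨w, hw, hz⟩
      obtain ⟨l, hl, hwl⟩ := ih.1 hw
      refine ⟨fun k => k.casesOn ((z : ℝ) - 4 * w) l, fun k => ?_, ?_⟩
      · cases k with
        | zero => rcases hz with rfl | rfl <;> simp
        | succ k => exact hl k
      · rw [Finset.sum_range_succ']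
        simp only [pow_succ', mul_assoc, ← Finset.mul_sum, ← hwl]
        simp
    · rintro ⟨l, hl, hz⟩
      have hint : ∃ w : ℤ, (w : ℝ) = ∑ k ∈ Finset.range n, 4 ^ k * l (k + 1) := by
        choose d hd using fun k => show ∃ d : ℤ, (d : ℝ) = l k from
          (hl k).elim (fun h => ⟨0, by simp [h]⟩) (fun h => ⟨m, by simp [h]⟩)
        exact ⟨∑ k ∈ Finset.range n, 4 ^ k * d (k + 1), by push_cast; simp [hd]⟩
      obtain ⟨w, hw⟩ := hint
      refine ⟨w, ih.2 ⟨fun k => l (k + 1), fun k => hl _, hw⟩, ?_⟩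
      rw [Finset.sum_range_succ'] at hz
      simp only [pow_succ', mul_assoc, ← Finset.mul_sum, ← hw] at hz
      rcases hl 0 with h | h
      · left
        rw [h] at hz
        exact_mod_cast (by simpa using hz : (z : ℝ) = 4 * w)
      · right
        rw [h] at hz
        exact_mod_cast (by simpa using hz : (z : ℝ) = 4 * w + m)

theorem mem_Gam_iff {m : ℕ} {x : ℝ} :
    x ∈ Gam m ↔ ∃ (n : ℕ) (z : ℤ), z ∈ digitSums m n ∧ x = z := by
  constructor
  · rintro ⟨n, l, hl, hx⟩
    choose d hd using fun k => show ∃ d : ℤ, (d : ℝ) = l k from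
      (hl k).elim (fun h => ⟨0, by simp [h]⟩) (fun h => ⟨m, by simp [h]⟩)
    have hz : ((∑ k ∈ Finset.range (n + 1), 4 ^ k * d k : ℤ) : ℝ) = x := by
      rw [hx]; push_cast; simp [hd]
    exact ⟨n + 1, _, mem_digitSums_iff.2 ⟨l, hl, hz.trans hx⟩, hz.symm⟩
  · rintro ⟨n, z, hz, rfl⟩
    -- `Gam` sums over `n + 1` digits and `digitSums m n` over `n`; monotonicity pads with a zero
    -- digit.
    obtain ⟨l, hl, h⟩ := mem_digitSums_iff.1 (digitSums_mono m n.le_succ hz)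
    exact ⟨n, l, hl, h⟩

theorem mul_mem_Gam {m : ℕ} (k : ℕ) {x : ℝ} (hx : x ∈ Gam (k * m)) : ∃ y ∈ Gam m, x = k * y := by
  classical
  obtain ⟨n, l, hl, rfl⟩ := hx
  refine ⟨_, ⟨n, fun j => if l j = 0 then 0 else m, fun j => by dsimp only; split_ifs <;> simp,
    rfl⟩, ?_⟩
  rw [Finset.mul_sum]
  refine Finset.sum_congr rfl fun j _ => ?_
  rcases eq_or_ne (l j) 0 with h | h
  · simp [h]
  · simp only [if_neg h]
    rw [(hl j).resolve_left h]
    push_cast; ring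

/-- If the lowest digits differ, the difference is odd because `m` is; if they agree, they cancel
and a factor `4` can be removed. -/
theorem fourier_sub_eq_zero {m : ℕ} (hm : Odd m) {n : ℕ} {z w : ℤ} (hz : z ∈ digitSums m n)
    (hw : w ∈ digitSums m n) (hne : z ≠ w) : fourier ((z : ℝ) - w) = 0 := by
  have hm' : Odd (m : ℤ) := (Int.odd_coe_nat m).2 hm
  induction n generalizing z w with
  | zero =>
    simp only [digitSums, Finset.mem_singleton] at hz hw
    exact absurd (hz.trans hw.symm) hne
  | succ n ih =>
    obtain ⟨z', hz', h1⟩ := mem_digitSums_succ.1 hz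
    obtain ⟨w', hw', h2⟩ := mem_digitSums_succ.1 hw
    have hcase : z - w = 4 * (z' - w') ∨ Odd (z - w) := by
      obtain ⟨j, hj⟩ := hm'
      rcases h1 with rfl | rfl <;> rcases h2 with rfl | rfl
      · left; ring
      · right; exact ⟨2 * (z' - w') - j - 1, by rw [hj]; ring⟩
      · right; exact ⟨2 * (z' - w') + j, by rw [hj]; ring⟩
      · left; ring
    rw [← Int.cast_sub]
    rcases hcase with h | h
    · have hne' : z' ≠ w' := by
        rintro rfl
        exact hne (by omega)
      rw [h, Int.cast_mul, Int.cast_ofNat, fourier_four_mul_int, Int.cast_sub]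
      exact ih hz' hw' hne'
    · exact fourier_odd h

theorem orthonormal_expLp_Gam {m : ℕ} (hm : Odd m) :
    Orthonormal ℂ fun lam : Gam m => expLp cantorMeasure lam := by
  refine ⟨fun _ => norm_expLp _, fun lam lam' hne => ?_⟩
  obtain ⟨n, z, hz, h1⟩ := mem_Gam_iff.1 lam.2
  obtain ⟨n', w, hw, h2⟩ := mem_Gam_iff.1 lam'.2
  rw [inner_expLp, h1, h2]
  refine fourier_sub_eq_zero hm (digitSums_mono m (le_max_right n n') hw)
    (digitSums_mono m (le_max_left n n') hz) ?_
  rintro rfl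
  exact hne (Subtype.ext (h1.trans h2.symm))

/-! ### The spectral function -/

/-- The partial sums of `∑ |μ̂(t + lam)|²` over `lam ∈ Γ(m)`. -/
noncomputable def partialSpectral (m n : ℕ) (t : ℝ) : ℝ :=
  ∑ z ∈ digitSums m n, ‖fourier (t + z)‖ ^ 2

theorem continuous_partialSpectral (m n : ℕ) : Continuous (partialSpectral m n) := by
  unfold partialSpectral
  exact continuous_finsetSum _ fun z _ =>
    ((continuous_fourier.comp (continuous_id.add continuous_const)).norm.pow 2)

theorem fourier_add_four_mul (t : ℝ) (z : ℤ) :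
    fourier (t + 4 * z) = symbol t * fourier (t / 4 + z) := by
  have h : t + 4 * (z : ℝ) = t + 2 * ((2 * z : ℤ) : ℝ) := by push_cast; ring
  rw [fourier_eq, h, symbol_add_even]
  congr 2
  push_cast; ring

/-- Sort the sums by their lowest digit, `4w` or `4w + m`; since `m` is odd, the two classes are
disjoint. In each, `symbol` does not see `4w` and factors out. -/
theorem partialSpectral_succ {m : ℕ} (hm : Odd m) (n : ℕ) (t : ℝ) :
    partialSpectral m (n + 1) t = ‖symbol t‖ ^ 2 * partialSpectral m n (t / 4) +
      ‖symbol (t + m)‖ ^ 2 * partialSpectral m n ((t + m) / 4) := by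
  have hm' : Odd (m : ℤ) := (Int.odd_coe_nat m).2 hm
  have hdisj : Disjoint ((digitSums m n).image (4 * ·))
      ((digitSums m n).image (4 * · + (m : ℤ))) := by
    simp only [Finset.disjoint_left, Finset.mem_image]
    rintro _ ⟨w, _, rfl⟩ ⟨w', _, h⟩
    obtain ⟨j, hj⟩ := hm'
    omega
  rw [partialSpectral, digitSums, Finset.sum_union hdisj,
    Finset.sum_image fun _ _ _ _ h => by simpa using h,
    Finset.sum_image fun _ _ _ _ h => by simpa using h,
    partialSpectral, partialSpectral, Finset.mul_sum, Finset.mul_sum]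
  congr 1 <;> refine Finset.sum_congr rfl fun z _ => ?_
  · rw [← mul_pow, ← norm_mul, ← fourier_add_four_mul]
    push_cast; rfl
  · rw [← mul_pow, ← norm_mul, ← fourier_add_four_mul]
    push_cast
    rw [add_assoc, add_comm (m : ℝ)]

/-- A form of Bessel's inequality, with an additional vector `f` orthogonal to the family. -/
theorem norm_sq_inner_le_of_orthonormal {𝕜 E ι : Type*} [RCLike 𝕜] [NormedAddCommGroup E]
    [InnerProductSpace 𝕜 E] [Fintype ι] {v : ι → E} (hv : Orthonormal 𝕜 v) {f : E}
    (hf : ∀ i, inner 𝕜 f (v i) = 0) (x : E) :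
    ‖inner 𝕜 f x‖ ^ 2 ≤ ‖f‖ ^ 2 * (‖x‖ ^ 2 - ∑ i, ‖inner 𝕜 (v i) x‖ ^ 2) := by
  rcases eq_or_ne f 0 with rfl | hne
  · simp
  have hnorm : ‖f‖ ≠ 0 := norm_ne_zero_iff.2 hne
  -- Adjoin the normalized `f` to the family and apply the usual Bessel inequality.
  let v' : Option ι → E := fun o => o.elim ((‖f‖⁻¹ : 𝕜) • f) v
  have hv' : Orthonormal 𝕜 v' := by
    constructor
    · rintro (_ | i)
      · simp [v', norm_smul, hnorm]
      · exact hv.1 i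
    · rintro (_ | i) (_ | j) hij
      · exact absurd rfl hij
      · simp [v', inner_smul_left, hf]
      · simp [v', inner_smul_right, inner_eq_zero_symm.1 (hf i)]
      · exact hv.2 (by simpa using hij)
  have h2 := hv'.sum_inner_products_le (s := Finset.univ) x
  rw [Fintype.sum_option] at h2
  simp only [v', Option.elim, inner_smul_left, norm_mul, map_inv₀, RCLike.conj_ofReal, norm_inv,
    RCLike.norm_ofReal, abs_norm, mul_pow] at h2
  have h3 : ‖f‖ ^ 2 * (‖f‖⁻¹ ^ 2 * ‖inner 𝕜 f x‖ ^ 2) = ‖inner 𝕜 f x‖ ^ 2 := by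
    field_simp
  nlinarith [mul_le_mul_of_nonneg_left (le_sub_iff_add_le.2 h2) (sq_nonneg ‖f‖)]

theorem orthonormal_expLp_digitSums {m : ℕ} (hm : Odd m) (n : ℕ) :
    Orthonormal ℂ fun z : digitSums m n => expLp cantorMeasure ((z : ℤ) : ℝ) :=
  (orthonormal_expLp_Gam hm).comp
    (fun z : digitSums m n => (⟨_, mem_Gam_iff.2 ⟨n, z, z.2, rfl⟩⟩ : Gam m))
    fun z w h => Subtype.ext (by simpa using h)

theorem sum_norm_sq_inner_expLp (m n : ℕ) (t : ℝ) :
    ∑ z : digitSums m n,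
      ‖inner ℂ (expLp cantorMeasure ((z : ℤ) : ℝ)) (expLp cantorMeasure (-t))‖ ^ 2 =
      partialSpectral m n t := by
  rw [partialSpectral, ← Finset.sum_coe_sort (digitSums m n)]
  refine Finset.sum_congr rfl fun z _ => ?_
  rw [← norm_inner_symm, inner_expLp]
  congr 3
  ring

theorem norm_sq_inner_expLp_le {m : ℕ} (hm : Odd m) {f : Lp ℂ 2 cantorMeasure}
    (hf : ∀ lam ∈ Gam m, inner ℂ f (expLp cantorMeasure lam) = 0) (n : ℕ) (t : ℝ) :
    ‖inner ℂ f (expLp cantorMeasure (-t))‖ ^ 2 ≤ ‖f‖ ^ 2 * (1 - partialSpectral m n t) := by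
  have h := norm_sq_inner_le_of_orthonormal (orthonormal_expLp_digitSums hm n) (f := f)
    (fun z => hf _ (mem_Gam_iff.2 ⟨n, z, z.2, rfl⟩)) (expLp cantorMeasure (-t))
  rwa [sum_norm_sq_inner_expLp, norm_expLp, one_pow] at h

theorem partialSpectral_le_one {m : ℕ} (hm : Odd m) (n : ℕ) (t : ℝ) :
    partialSpectral m n t ≤ 1 := by
  have h := (orthonormal_expLp_digitSums hm n).sum_inner_products_le (s := Finset.univ)
    (expLp cantorMeasure (-t))
  rwa [sum_norm_sq_inner_expLp, norm_expLp, one_pow] at h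

/-- The function `t ↦ ∑ |μ̂(t + lam)|²`, the sum over `lam ∈ Γ(m)`. -/
noncomputable def spectral (m : ℕ) (t : ℝ) : ℝ := ⨆ n, partialSpectral m n t

theorem bddAbove_partialSpectral {m : ℕ} (hm : Odd m) (t : ℝ) :
    BddAbove (Set.range fun n => partialSpectral m n t) :=
  ⟨1, Set.forall_mem_range.2 fun n => partialSpectral_le_one hm n t⟩

theorem partialSpectral_le_spectral {m : ℕ} (hm : Odd m) (n : ℕ) (t : ℝ) :
    partialSpectral m n t ≤ spectral m t :=
  le_ciSup (bddAbove_partialSpectral hm t) n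

theorem tendsto_partialSpectral {m : ℕ} (hm : Odd m) (t : ℝ) :
    Tendsto (fun n => partialSpectral m n t) atTop (𝓝 (spectral m t)) :=
  tendsto_atTop_ciSup (fun _ _ h => Finset.sum_le_sum_of_subset_of_nonneg (digitSums_mono m h)
    fun _ _ _ => sq_nonneg _) (bddAbove_partialSpectral hm t)

/-- A supremum of continuous functions. This suffices both for attaining the minimum and for
comparing it with the value at `0`. -/
theorem lowerSemicontinuous_spectral {m : ℕ} (hm : Odd m) : LowerSemicontinuous (spectral m) :=
  lowerSemicontinuous_ciSup (bddAbove_partialSpectral hm)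
    fun n => (continuous_partialSpectral m n).lowerSemicontinuous

theorem spectral_eq {m : ℕ} (hm : Odd m) (t : ℝ) :
    spectral m t = ‖symbol t‖ ^ 2 * spectral m (t / 4) +
      ‖symbol (t + m)‖ ^ 2 * spectral m ((t + m) / 4) := by
  refine tendsto_nhds_unique ((tendsto_add_atTop_iff_nat 1).2 (tendsto_partialSpectral hm t)) ?_
  simp only [partialSpectral_succ hm]
  exact ((tendsto_partialSpectral hm _).const_mul _).add
    ((tendsto_partialSpectral hm _).const_mul _)

theorem one_le_spectral_zero {m : ℕ} (hm : Odd m) : 1 ≤ spectral m 0 := by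
  refine le_trans ?_ (partialSpectral_le_spectral hm 0 0)
  simp [partialSpectral, digitSums]

/-- If the spectral function takes its minimum over `[-R, R]` at `t` and some `μ̂(t + lam)` is
not zero, then that minimum is at least `1`: it is also taken at points that tend to `0`. -/
theorem one_le_of_isMinOn_spectral {m : ℕ} (hm : Odd m) {R a : ℝ} (hR : (m : ℝ) ≤ R)
    (ha : ∀ x, |x| ≤ R → a ≤ spectral m x) {n : ℕ} {t : ℝ} (ht : |t| ≤ R)
    (hta : spectral m t ≤ a) {z : ℤ} (hz : z ∈ digitSums m n) (hne : fourier (t + z) ≠ 0) :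
    1 ≤ a := by
  have hm0 : (0 : ℝ) ≤ m := m.cast_nonneg
  have habs0 {x : ℝ} (hx : |x| ≤ R) : |x / 4| ≤ R := by
    rw [abs_le] at *; constructor <;> linarith
  have habs1 {x : ℝ} (hx : |x| ≤ R) : |(x + m) / 4| ≤ R := by
    rw [abs_le] at *; constructor <;> linarith
  have hsum (x : ℝ) := norm_sq_symbol_add_odd x ((Int.odd_coe_nat m).2 hm)
  simp only [Int.cast_natCast] at hsum
  -- A weighted mean of two values `≥ a` is `≤ a`, so a value with positive weight is itself `≤ a`.
  have step0 {x : ℝ} (hx : |x| ≤ R) (hxa : spectral m x ≤ a) (h : symbol x ≠ 0) :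
      spectral m (x / 4) ≤ a := by
    have h0 : 0 < ‖symbol x‖ ^ 2 := by positivity
    have h1 := mul_le_mul_of_nonneg_left (ha _ (habs1 hx)) (sq_nonneg ‖symbol (x + m)‖)
    have h2 := spectral_eq hm x
    refine le_of_mul_le_mul_left ?_ h0
    linear_combination hxa + h1 - h2 - a * hsum x
  have step1 {x : ℝ} (hx : |x| ≤ R) (hxa : spectral m x ≤ a) (h : symbol (x + m) ≠ 0) :
      spectral m ((x + m) / 4) ≤ a := by
    have h0 : 0 < ‖symbol (x + m)‖ ^ 2 := by positivity
    have h1 := mul_le_mul_of_nonneg_left (ha _ (habs0 hx)) (sq_nonneg ‖symbol x‖)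
    have h2 := spectral_eq hm x
    refine le_of_mul_le_mul_left ?_ h0
    linear_combination hxa + h1 - h2 - a * hsum x
  induction n generalizing t z with
  | zero =>
    obtain rfl : z = 0 := by simpa [digitSums] using hz
    rw [Int.cast_zero, add_zero] at hne
    -- With the digits of `z` used up, follow the branch `x ↦ x / 4`; its weights are nonzero
    -- because they are factors of `fourier t`.
    have hall (k : ℕ) : |t / 4 ^ k| ≤ R ∧ spectral m (t / 4 ^ k) ≤ a ∧ fourier (t / 4 ^ k) ≠ 0 := by
      induction k with
      | zero => simpa using ⟨ht, hta, hne⟩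
      | succ k ih =>
        obtain ⟨h1, h2, h3⟩ := ih
        rw [fourier_eq] at h3
        rw [pow_succ, ← div_div]
        exact ⟨habs0 h1, step0 h1 h2 (left_ne_zero_of_mul h3), right_ne_zero_of_mul h3⟩
    refine (one_le_spectral_zero hm).trans (le_of_forall_lt fun c hc => ?_)
    obtain ⟨k, hk⟩ := ((tendsto_div_four_pow t).eventually
      (lowerSemicontinuous_spectral hm 0 c hc)).exists
    exact hk.trans_le (hall k).2.1
  | succ n ih =>
    obtain ⟨w, hw, rfl | rfl⟩ := mem_digitSums_succ.1 hz
    · rw [Int.cast_mul, Int.cast_ofNat, fourier_add_four_mul] at hne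
      exact ih (habs0 ht) (step0 ht hta (left_ne_zero_of_mul hne)) hw (right_ne_zero_of_mul hne)
    · have h : t + ((4 * w + m : ℤ) : ℝ) = t + m + 4 * w := by push_cast; ring
      rw [h, fourier_add_four_mul] at hne
      exact ih (habs1 ht) (step1 ht hta (left_ne_zero_of_mul hne)) hw (right_ne_zero_of_mul hne)

theorem one_le_spectral {m : ℕ} (hm : Odd m)
    (h : ∀ x : ℤ, ∃ lam ∈ Gam m, fourier (x + lam) ≠ 0) (t : ℝ) : 1 ≤ spectral m t := by
  have hR : (m : ℝ) ≤ max (m : ℝ) |t| := le_max_left _ _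
  have hne : (Set.Icc (-max (m : ℝ) |t|) (max (m : ℝ) |t|)).Nonempty :=
    ⟨t, abs_le.1 (le_max_right _ _)⟩
  obtain ⟨x, hx, hmin⟩ := (lowerSemicontinuous_spectral hm).lowerSemicontinuousOn _
    |>.exists_isMinOn hne isCompact_Icc
  have hall : ∃ (n : ℕ) (z : ℤ), z ∈ digitSums m n ∧ fourier (x + z) ≠ 0 := by
    -- A minimum point where `fourier` vanishes is an integer, so `h` applies; otherwise `λ = 0`
    -- serves.
    by_cases hx0 : fourier x = 0
    · obtain ⟨n, z, -, rfl⟩ := fourier_eq_zero_iff.1 hx0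
      obtain ⟨lam, hlam, hf⟩ := h (4 ^ n * z)
      obtain ⟨k, w, hw, rfl⟩ := mem_Gam_iff.1 hlam
      exact ⟨k, w, hw, by exact_mod_cast hf⟩
    · exact ⟨0, 0, by simp [digitSums], by simpa using hx0⟩
  obtain ⟨n, z, hz, hf⟩ := hall
  refine (one_le_of_isMinOn_spectral hm hR (fun y hy => ?_) (abs_le.2 hx) le_rfl hz hf).trans
    (hmin (abs_le.1 (le_max_right _ _)))
  exact hmin (abs_le.1 hy)

/-! ### Completeness -/

/-- An odd number `m` is complete if and only if no exponential function with an integer frequency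
is orthogonal to all `e_lam`, `lam ∈ Γ(m)`. -/
theorem isComplete_iff {m : ℕ} (hm : Odd m) :
    IsComplete m ↔ ∀ x : ℤ, ∃ lam ∈ Gam m, fourier (x + lam) ≠ 0 := by
  constructor
  · rintro ⟨b, hb⟩ x
    by_contra! hx
    have hzero : expLp cantorMeasure (-x) = 0 := by
      rw [← b.repr.map_eq_zero_iff]
      ext lam
      rw [b.repr_apply_apply, hb, ← inner_conj_symm, inner_expLp]
      have := hx lam lam.2
      rw [sub_neg_eq_add, add_comm, this]
      simp
    have := norm_expLp (-x)
    rw [hzero, norm_zero] at this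
    exact zero_ne_one this
  · intro h
    refine ⟨HilbertBasis.mkOfOrthogonalEqBot (orthonormal_expLp_Gam hm) ?_, fun lam => by
      rw [HilbertBasis.coe_mkOfOrthogonalEqBot]⟩
    rw [Submodule.eq_bot_iff]
    intro f hf
    rw [Submodule.mem_orthogonal'] at hf
    refine eq_zero_of_forall_inner_expLp_eq_zero fun t => ?_
    rw [inner_eq_zero_symm]
    -- For `f` orthogonal to the family, the Bessel defect at `-t` bounds the inner product with
    -- `e_t`; it tends to `1 - spectral m (-t) ≤ 0`.
    have hle (n : ℕ) := norm_sq_inner_expLp_le hm (f := f)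
      (fun lam hlam => hf _ (Submodule.subset_span ⟨⟨lam, hlam⟩, rfl⟩)) n (-t)
    rw [neg_neg] at hle
    have hlim := ge_of_tendsto' (((tendsto_partialSpectral hm (-t)).const_sub 1).const_mul
      (‖f‖ ^ 2)) hle
    have h1 := one_le_spectral hm h (-t)
    have h2 : ‖inner ℂ f (expLp cantorMeasure t)‖ ^ 2 ≤ 0 :=
      hlim.trans (mul_nonpos_of_nonneg_of_nonpos (sq_nonneg _) (by linarith))
    exact norm_eq_zero.1 (pow_eq_zero_iff two_ne_zero |>.1 (le_antisymm h2 (sq_nonneg _)))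

/-! ### Odd multiples and primitive divisors -/

theorem IsIncomplete.odd_mul {m k : ℕ} (hm : Odd m) (hk : Odd k) (h : IsIncomplete m) :
    IsIncomplete (k * m) := by
  rw [IsIncomplete, isComplete_iff hm] at h
  rw [IsIncomplete, isComplete_iff (hk.mul hm)]
  push Not at h ⊢
  obtain ⟨x, hx⟩ := h
  refine ⟨k * x, fun lam hlam => ?_⟩
  obtain ⟨y, hy, rfl⟩ := mul_mem_Gam k hlam
  have := fourier_odd_mul_eq_zero hk (hx y hy)
  push_cast
  rwa [← mul_add]

theorem IsIncomplete.exists_isPrimitive_dvd {m : ℕ} (hm : Odd m) (h : IsIncomplete m) :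
    ∃ p : ℕ, IsPrimitive p ∧ p ∣ m := by
  induction m using Nat.strong_induction_on with
  | _ m ih =>
    by_cases hp : IsPrimitive m
    · exact ⟨m, hp, dvd_rfl⟩
    · have : ∃ d ∈ m.properDivisors, ¬ IsComplete d := by
        by_contra! hd
        exact hp ⟨hm, h, hd⟩
      obtain ⟨d, hd, hdi⟩ := this
      obtain ⟨hdvd, hlt⟩ := Nat.mem_properDivisors.1 hd
      obtain ⟨p, hpp, hpd⟩ := ih d hlt (hm.of_dvd_nat hdvd) hdi
      exact ⟨p, hpp, hpd.trans hdvd⟩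

end CantorSpectrum

theorem proposition2p5 :
    (∀ m k : ℕ, Odd m → Odd k →
      CantorSpectrum.IsIncomplete m → CantorSpectrum.IsIncomplete (k * m)) ∧
    (∀ m : ℕ, Odd m →
      (CantorSpectrum.IsIncomplete m ↔ ∃ p : ℕ, CantorSpectrum.IsPrimitive p ∧ p ∣ m)) := by
  refine ⟨fun m k hm hk h => h.odd_mul hm hk, fun m hm =>
    ⟨fun h => h.exists_isPrimitive_dvd hm, ?_⟩⟩
  rintro ⟨p, hp, k, rfl⟩
  rw [mul_comm]
  exact hp.2.1.odd_mul hp.1 (Nat.odd_mul.1 hm).2
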